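/- Let $V$ be a finite-dimensional vector space over $\mathbb{F}_2$ with a quadratic form $Q$, let $f(v,w)=Q(v+w)+Q(v)+Q(w)$ be its associated alternating form, and put $\mathrm{Rad}(f)=\{v\in V\mid f(v,w)=0 \text{ for all } w\in V\}$ and $\mathrm{Rad}(Q)=\{v\in\mathrm{Rad}(f)\mid Q(v)=0\}$. Let $\overline{Q}$ be the form induced by $Q$ on $\overline{V}=V/\mathrm{Rad}(Q)$, and let $n=\dim\overline{V}$ and $r=\dim\mathrm{Rad}(f)$. A quadratic form $q$ on a finite-dimensional $\mathbb{F}_2$-space $W$ is of type $+$, $-$ or $0$ if $W$ is an orthogonal direct sum $W_1\perp\cdots\perp W_k\perp\mathrm{Rad}(q)$ (with $k\ge 0$) where, respectively: every $W_i$ is a plane isometric to $x_1x_2$; exactly one $W_i$ is a plane isometric to $x_1^2+x_1x_2+x_2^2$ and all the others are planes isometric to $x_1x_2$; exactly one $W_i$ is a line isometric to $x^2$ and all the others are planes isometric to $x_1x_2$. Let $\mathbb{F}$ be a field of characteristic $\neq 2$. It is of type I if $-1$ is a square in $\mathbb{F}$; of type II if $-1$ is not a square but $x^2+y^2=-1$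 for some $x,y\in\mathbb{F}$; of type III if there are no such $x,y$. Let $g$ be any bilinear form on $V$ with $g(v,v)=Q(v)$ for all $v\in V$, and let $\mathfrak{C}(V,Q)$ be the associative $\mathbb{F}$-algebra with basis $\{e_v\mid v\in V\}$ and product $e_ve_w=(-1)^{g(v,w)}e_{v+w}$. Let $M(2,\mathbb{F})^{\otimes k}$ be the $k$-fold tensor power over $\mathbb{F}$ of the algebra of $2\times2$ matrices, $\mathbb{F}[i]=\mathbb{F}[X]/(X^2+1)$, and $\mathbb{H}$ the algebra of quaternions over $\mathbb{F}$ (with $i^2=j^2=-1$, $ij=-ji$); for an algebra $A$, let $A^m$ be the product of $m$ copies of $A$. Then $\overline{Q}$ has exactly one of the types $+,-,0$, and $\mathfrak{C}(V,Q)$ is isomorphic, as an $\mathbb{F}$-algebra, to the following algebra. 1. If $\overline{Q}$ is of type $+$, then $n$ is even and $\mathfrak{C}(V,Q)\cong\bigl(M(2,\mathbb{F})^{\otimes n/2}\bigr)^{2^r}$. 2. If $\overline{Q}$ is of type $-$, then $n$ is even, $n\ge 2$, and $\mathfrak{C}(V,Q)\cong\bigl(M(2,\mathbb{F})^{\otimes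 n/2}\bigr)^{2^r}$ if $\mathbb{F}$ is of type I or II, while $\mathfrak{C}(V,Q)\cong\bigl(M(2,\mathbb{F})^{\otimes (n-2)/2}\otimes\mathbb{H}\bigr)^{2^r}$ if $\mathbb{F}$ is of type III. 3. If $\overline{Q}$ is of type $0$, then $n$ is odd, $r\ge 1$, and $\mathfrak{C}(V,Q)\cong\bigl(M(2,\mathbb{F})^{\otimes (n-1)/2}\bigr)^{2^r}$ if $\mathbb{F}$ is of type I, while $\mathfrak{C}(V,Q)\cong\bigl(M(2,\mathbb{F})^{\otimes (n-1)/2}\otimes\mathbb{F}[i]\bigr)^{2^{r-1}}$ if $\mathbb{F}$ is of type II or III. -/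

import Mathlib

open scoped TensorProduct

noncomputable section

/-- The underlying module of the algebra `ℭ(V, g)` over `R` (with `Λ = 1`): the free `R`-module
with basis `e_v`, `v ∈ V`. -/
def TwistedAlgebra (R : Type*) {V : Type*} [CommRing R] [AddCommGroup V] [Module (ZMod 2) V]
    (_g : LinearMap.BilinForm (ZMod 2) V) : Type _ :=
  V →₀ R

namespace TwistedAlgebra

/-- The sign `(-1) ^ a` for `a ∈ 𝔽₂`. -/
def sign (R : Type*) [CommRing R] (a : ZMod 2) : R := (-1) ^ a.val

theorem sign_zero (R : Type*) [CommRing R] : sign R 0 = 1 := by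
  simp [sign]

theorem sign_add (R : Type*) [CommRing R] (a b : ZMod 2) :
    sign R (a + b) = sign R a * sign R b := by
  rw [sign, sign, sign, ← pow_add, ZMod.val_add, ← neg_one_pow_eq_pow_mod_two]

variable {R V : Type*} [CommRing R] [AddCommGroup V] [Module (ZMod 2) V]
  (g : LinearMap.BilinForm (ZMod 2) V)

instance : AddCommGroup (TwistedAlgebra R g) := inferInstanceAs (AddCommGroup (V →₀ R))

instance : Module R (TwistedAlgebra R g) := inferInstanceAs (Module R (V →₀ R))

/-- The basis `(e_v)`, indexed by `v ∈ V`. -/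
def e : Module.Basis V R (TwistedAlgebra R g) := Module.Basis.ofRepr (LinearEquiv.refl R (V →₀ R))

/-- The bilinear product determined by `e_v e_w = (-1) ^ g(v, w) e_{v + w}`. -/
def mulHom : TwistedAlgebra R g →ₗ[R] TwistedAlgebra R g →ₗ[R] TwistedAlgebra R g :=
  (e g).constr R fun v => (e g).constr R fun w => sign R (g v w) • e g (v + w)

instance : Mul (TwistedAlgebra R g) := ⟨fun x y => mulHom g x y⟩

instance : One (TwistedAlgebra R g) := ⟨e g 0⟩

theorem mul_def (x y : TwistedAlgebra R g) : x * y = mulHom g x y := rfl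

theorem one_def : (1 : TwistedAlgebra R g) = e g 0 := rfl

theorem e_mul_e (v w : V) :
    (e g v * e g w : TwistedAlgebra R g) = sign R (g v w) • e g (v + w) := by
  simp [mul_def, mulHom]

theorem mulHom_assoc (x y z : TwistedAlgebra R g) :
    mulHom g (mulHom g x y) z = mulHom g x (mulHom g y z) := by
  have h : (mulHom g).compr₂ (mulHom g) =
      LinearMap.lcomp R _ (mulHom g) ∘ₗ LinearMap.llcomp R _ _ _ ∘ₗ mulHom g := by
    refine (e g).ext fun u => (e g).ext fun v => (e g).ext fun w => ?_
    simp [mulHom, smul_smul, sign_add, add_assoc]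
    ring_nf
  exact LinearMap.congr_fun (LinearMap.congr_fun (LinearMap.congr_fun h x) y) z

theorem one_mulHom (x : TwistedAlgebra R g) : mulHom g (e g 0) x = x := by
  have h : mulHom g (e (R := R) g 0) = LinearMap.id := by
    refine (e g).ext fun v => ?_
    simp [mulHom, sign_zero]
  rw [h, LinearMap.id_apply]

theorem mulHom_one (x : TwistedAlgebra R g) : mulHom g x (e g 0) = x := by
  have h : (mulHom g).flip (e (R := R) g 0) = LinearMap.id := by
    refine (e g).ext fun v => ?_
    simp [mulHom, sign_zero]
  exact LinearMap.congr_fun h x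

instance : Ring (TwistedAlgebra R g) :=
  { (inferInstance : AddCommGroup (TwistedAlgebra R g)),
    (inferInstance : Mul (TwistedAlgebra R g)),
    (inferInstance : One (TwistedAlgebra R g)) with
    left_distrib := fun x y z => by simp [mul_def]
    right_distrib := fun x y z => by simp [mul_def]
    zero_mul := fun x => by simp [mul_def]
    mul_zero := fun x => by simp [mul_def]
    mul_assoc := mulHom_assoc g
    one_mul := one_mulHom g
    mul_one := mulHom_one g }

instance : Algebra R (TwistedAlgebra R g) :=
  Algebra.ofModule (fun r x y => by simp [mul_def]) (fun r x y => by simp [mul_def])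

end TwistedAlgebra

/-- The radical of the alternating form `f(v, w) = Q(v + w) - Q(v) - Q(w)` of `Q`. (The radical
`{v ∈ Rad(f) | Q(v) = 0}` of `Q` itself is `QuadraticMap.radical`.) -/
def radPolar {V : Type*} [AddCommGroup V] [Module (ZMod 2) V] (Q : QuadraticForm (ZMod 2) V) :
    Submodule (ZMod 2) V :=
  LinearMap.ker Q.polarBilin

/-- The form induced by `Q` on `V / Rad(Q)`. -/
def inducedForm {V : Type*} [AddCommGroup V] [Module (ZMod 2) V] (Q : QuadraticForm (ZMod 2) V) :
    QuadraticForm (ZMod 2) (V ⧸ Q.radical) :=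
  Q.lift Q.radical le_rfl

/-- The `2`-dimensional form `x₁ x₂`. -/
def plusPlane : QuadraticForm (ZMod 2) (Fin 2 → ZMod 2) :=
  QuadraticMap.linMulLin (LinearMap.proj 0) (LinearMap.proj 1)

/-- The `2`-dimensional form `x₁² + x₁ x₂ + x₂²`. -/
def minusPlane : QuadraticForm (ZMod 2) (Fin 2 → ZMod 2) :=
  QuadraticMap.linMulLin (LinearMap.proj 0) (LinearMap.proj 0) +
    QuadraticMap.linMulLin (LinearMap.proj 0) (LinearMap.proj 1) +
    QuadraticMap.linMulLin (LinearMap.proj 1) (LinearMap.proj 1)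

/-- The `1`-dimensional form `x²`. -/
def zeroLine : QuadraticForm (ZMod 2) (ZMod 2) := QuadraticMap.sq

/-- `V` is the (internal) orthogonal direct sum `W₁ ⊥ ⋯ ⊥ W_k ⊥ Rad(Q)`. -/
def IsOrthogonalSum {V : Type*} [AddCommGroup V] [Module (ZMod 2) V]
    (Q : QuadraticForm (ZMod 2) V) {k : ℕ} (W : Fin k → Submodule (ZMod 2) V) : Prop :=
  DirectSum.IsInternal (fun o : Option (Fin k) => o.elim Q.radical W) ∧
    ∀ i j, i ≠ j → ∀ x ∈ W i, ∀ y ∈ W j, QuadraticMap.polar Q x y = 0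

/-- The three types of quadratic forms over `𝔽₂`. -/
inductive FormType : Type
  | plus
  | minus
  | zero

/-- `Q` is of the given type: `V = W₁ ⊥ ⋯ ⊥ W_k ⊥ Rad(Q)` where all `W_i` are planes of `+`-type,
except, for the types `-` and `0`, exactly one, which is a plane of `-`-type, respectively
a line of `0`-type. -/
def HasType {V : Type*} [AddCommGroup V] [Module (ZMod 2) V]
    (Q : QuadraticForm (ZMod 2) V) : FormType → Prop
  | .plus => ∃ (k : ℕ) (W : Fin k → Submodule (ZMod 2) V), IsOrthogonalSum Q W ∧
      ∀ i, (Q.restrict (W i)).Equivalent plusPlane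
  | .minus => ∃ (k : ℕ) (W : Fin k → Submodule (ZMod 2) V), IsOrthogonalSum Q W ∧
      ∃ j, (Q.restrict (W j)).Equivalent minusPlane ∧
        ∀ i, i ≠ j → (Q.restrict (W i)).Equivalent plusPlane
  | .zero => ∃ (k : ℕ) (W : Fin k → Submodule (ZMod 2) V), IsOrthogonalSum Q W ∧
      ∃ j, (Q.restrict (W j)).Equivalent zeroLine ∧
        ∀ i, i ≠ j → (Q.restrict (W i)).Equivalent plusPlane

/-- Fields of type I: `-1` is a square. -/
def IsTypeI (F : Type*) [Field F] : Prop := ∃ i : F, i ^ 2 = -1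

/-- Fields of type II: `-1` is not a square, but a sum of two squares. -/
def IsTypeII (F : Type*) [Field F] : Prop :=
  (¬ ∃ i : F, i ^ 2 = -1) ∧ ∃ x y : F, x ^ 2 + y ^ 2 = -1

/-- Fields of type III: `-1` is not a sum of two squares. -/
def IsTypeIII (F : Type*) [Field F] : Prop := ¬ ∃ x y : F, x ^ 2 + y ^ 2 = -1

/-- The `k`-fold tensor power `M(2, F)^{⊗ k}` over `F`. -/
abbrev MatTensor (F : Type*) [Field F] (k : ℕ) : Type _ :=
  ⨂[F] _ : Fin k, Matrix (Fin 2) (Fin 2) F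

/-- The algebra `F[i]` with `i² = -1`. -/
abbrev GaussExt (F : Type*) [Field F] : Type _ :=
  AdjoinRoot (Polynomial.X ^ 2 + 1 : Polynomial F)

end

/-! In the twisted algebra `e_v² = (-1)^{Q(v)}`, and `e_v`, `e_w` commute or anticommute according
to `f(v, w)`. Orthogonal summands therefore give commuting subalgebras, and the algebra of an
orthogonal sum is the tensor product of the algebras of the summands
(`TwistedAlgebra.nonempty_algEquiv_tensorProduct`). `IsTwistedModel` quantifies over all `g` with
diagonal `Q`, because transport to a summand yields some such `g` with no control over which one.

It remains to know the small pieces. The plane `x₁x₂` gives two anticommuting generators of square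
`1`, hence `M(2, F)`. The plane `x₁² + x₁x₂ + x₂²` gives the quaternions, which become `M(2, F)`
once `-1` is a sum of two squares. The line `x²` gives `F[i]`, which is `F²` once `-1` is a square.
The zero form on `Rad(Q)` gives a power of `F`, as `2` is invertible. Finally `V` is isometric to `V
/ Rad(Q) ⊥ Rad(Q)` (`equivalent_inducedForm_prod_zero`).

A type exists because planes `x₁x₂` can be split off while there are nonzero singular vectors, and
what remains has dimension at most 2 (`exists_decomposesAs`). It is unique because `∑ (-1)^{Q(v)}`
is multiplicative over orthogonal sums and equals `2`, `-2`, `0` on the three pieces, so that its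
sign detects the type (`existsUnique_hasType`). `HasInvariants` carries this sum, the two dimensions
and the algebra through the decomposition together, so one induction yields everything. -/

theorem AlgHom.nonempty_algEquiv_of_surjective {F A B : Type*} [Field F] [Ring A] [Algebra F A]
    [Ring B] [Algebra F B] [Module.Finite F A] [Module.Finite F B] (f : A →ₐ[F] B)
    (hf : Function.Surjective f) (h : Module.finrank F A = Module.finrank F B) :
    Nonempty (A ≃ₐ[F] B) :=
  ⟨AlgEquiv.ofBijective f
    ⟨(LinearMap.injective_iff_surjective_of_finrank_eq_finrank (f := f.toLinearMap) h).2 hf, hf⟩⟩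

/-! ### Homomorphisms and tensor decompositions of twisted algebras -/

namespace TwistedAlgebra

section Lift

variable {R V A : Type*} [CommRing R] [AddCommGroup V] [Module (ZMod 2) V] [Ring A] [Algebra R A]
  (g : LinearMap.BilinForm (ZMod 2) V)

/-- The algebra homomorphism sending `e_v` to `a v`. -/
noncomputable def lift (a : V → A) (h0 : a 0 = 1)
    (hm : ∀ v w, a v * a w = sign R (g v w) • a (v + w)) : TwistedAlgebra R g →ₐ[R] A :=
  AlgHom.ofLinearMap ((e g).constr R a) (by simp [one_def, h0]) (by
    intro x y
    have h : (LinearMap.mul R (TwistedAlgebra R g)).compr₂ ((e g).constr R a) =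
        (LinearMap.mul R A).compl₁₂ ((e g).constr R a) ((e g).constr R a) := by
      refine (e g).ext fun v => (e g).ext fun w => ?_
      simp [e_mul_e, hm]
    exact LinearMap.congr_fun (LinearMap.congr_fun h x) y)

@[simp]
theorem lift_e (a : V → A) (h0 : a 0 = 1)
    (hm : ∀ v w, a v * a w = sign R (g v w) • a (v + w)) (v : V) :
    lift g a h0 hm (e g v) = a v :=
  (e g).constr_basis R a v

theorem sign_mul_self (a : ZMod 2) : sign R a * sign R a = 1 := by
  rw [← sign_add, CharTwo.add_self_eq_zero, sign_zero]

theorem sign_one : sign R 1 = -1 := by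
  simp [sign, ZMod.val_one]

theorem e_add (v w : V) : (e g (v + w) : TwistedAlgebra R g) = sign R (g v w) • (e g v * e g w) := by
  rw [e_mul_e, smul_smul, sign_mul_self, one_smul]

theorem e_mul_self (v : V) : (e g v * e g v : TwistedAlgebra R g) = algebraMap R _ (sign R (g v v)) := by
  rw [e_mul_e, ZModModule.add_self, ← one_def, Algebra.algebraMap_eq_smul_one]

theorem surjective_of_e_mem_range (f : A →ₐ[R] TwistedAlgebra R g)
    (h : ∀ v, e g v ∈ f.range) : Function.Surjective f := by
  rw [← AlgHom.range_eq_top, eq_top_iff]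
  intro x _
  have : (⊤ : Submodule R (TwistedAlgebra R g)) ≤ Subalgebra.toSubmodule f.range := by
    rw [← (e g).span_eq, Submodule.span_le]
    rintro _ ⟨v, rfl⟩
    exact h v
  exact this trivial

instance [Finite V] : Module.Finite R (TwistedAlgebra R g) := Module.Finite.of_basis (e g)

theorem finrank_eq [StrongRankCondition R] [Finite V] :
    Module.finrank R (TwistedAlgebra R g) = Nat.card V := by
  have := Fintype.ofFinite V
  rw [Module.finrank_eq_card_basis (e g), Nat.card_eq_fintype_card]

end Lift

variable {F V A : Type*} [Field F] [AddCommGroup V] [Module (ZMod 2) V] [Ring A] [Algebra F A]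
  (g : LinearMap.BilinForm (ZMod 2) V)

/-- Equality of dimensions makes injectivity automatic, so a model is recognised by mapping it into
the twisted algebra and hitting every basis vector. -/
theorem nonempty_algEquiv_of_e_mem_range [Finite V] [Module.Finite F A]
    (hA : Module.finrank F A = Nat.card V) (f : A →ₐ[F] TwistedAlgebra F g)
    (h : ∀ v, e g v ∈ f.range) : Nonempty (TwistedAlgebra F g ≃ₐ[F] A) :=
  (f.nonempty_algEquiv_of_surjective (surjective_of_e_mem_range g f h)
    (by rw [hA, finrank_eq])).map AlgEquiv.symm

variable {V₁ V₂ : Type*} [AddCommGroup V₁] [Module (ZMod 2) V₁] [AddCommGroup V₂]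
  [Module (ZMod 2) V₂]

theorem commute_e {v w : V} (h : g v w = g w v) : Commute (e (R := F) g v) (e g w) := by
  rw [Commute, SemiconjBy, e_mul_e, e_mul_e, h, add_comm]

/-- The homomorphism induced by a linear map. -/
noncomputable def map (φ : V₁ →ₗ[ZMod 2] V) :
    TwistedAlgebra F (g.compl₁₂ φ φ) →ₐ[F] TwistedAlgebra F g :=
  lift _ (fun v => e g (φ v)) (by rw [map_zero, one_def]) (fun v w => by simp [e_mul_e])

@[simp]
theorem map_e (φ : V₁ →ₗ[ZMod 2] V) (v : V₁) :
    map (F := F) g φ (e _ v) = e g (φ v) := by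
  simp [map]

theorem nonempty_algEquiv_compl₁₂ [Finite V] (φ : V₁ ≃ₗ[ZMod 2] V) :
    Nonempty (TwistedAlgebra F g ≃ₐ[F]
      TwistedAlgebra F (g.compl₁₂ φ.toLinearMap φ.toLinearMap)) := by
  have : Finite V₁ := Finite.of_equiv V φ.symm.toEquiv
  refine nonempty_algEquiv_of_e_mem_range g ?_ (map g φ.toLinearMap) fun v => ⟨e _ (φ.symm v), ?_⟩
  · rw [finrank_eq, Nat.card_congr φ.toEquiv]
  · simp

/-- Symmetry of `g` across the summands makes the two subalgebras commute, so their inclusions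
extend to the tensor product. This map reaches every basis vector because `e_(v,w)` is `± e_(v,0)
e_(0,w)`. The values of `g` across the summands need not vanish. -/
theorem nonempty_algEquiv_tensorProduct [Finite V₁] [Finite V₂]
    (g : LinearMap.BilinForm (ZMod 2) (V₁ × V₂))
    (h : ∀ v w, g (v, 0) (0, w) = g (0, w) (v, 0)) :
    Nonempty (TwistedAlgebra F g ≃ₐ[F]
      TwistedAlgebra F (g.compl₁₂ (LinearMap.inl _ _ _) (LinearMap.inl _ _ _)) ⊗[F]
      TwistedAlgebra F (g.compl₁₂ (LinearMap.inr _ _ _) (LinearMap.inr _ _ _))) := by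
  set i₁ := LinearMap.inl (ZMod 2) V₁ V₂
  set i₂ := LinearMap.inr (ZMod 2) V₁ V₂
  refine nonempty_algEquiv_of_e_mem_range g ?_
    (Algebra.TensorProduct.lift (map g i₁) (map g i₂) ?_) ?_
  · rw [Module.finrank_tensorProduct, finrank_eq, finrank_eq, Nat.card_prod]
  · intro x y
    -- Commutation is extended from basis vectors to all elements one argument at a time, as an
    -- equality of linear maps.
    have key : ∀ v, ∀ y, Commute (e (R := F) g (i₁ v)) (map g i₂ y) := by
      intro v y
      have := LinearMap.congr_fun ((e _).ext (f₁ := LinearMap.mulLeft F (e g (i₁ v)) ∘ₗ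
        (map (F := F) g i₂).toLinearMap) (f₂ := LinearMap.mulRight F (e g (i₁ v)) ∘ₗ
        (map (F := F) g i₂).toLinearMap) fun w => ?_) y
      · exact this
      · simpa [i₁, i₂] using (commute_e g (h v w)).eq
    have := LinearMap.congr_fun ((e _).ext (f₁ := LinearMap.mulRight F (map g i₂ y) ∘ₗ
        (map (F := F) g i₁).toLinearMap) (f₂ := LinearMap.mulLeft F (map g i₂ y) ∘ₗ
        (map (F := F) g i₁).toLinearMap) fun w => ?_) x
    · exact this
    · simpa using (key w y).eq
  · rintro ⟨v, w⟩
    rw [AlgHom.mem_range]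
    refine ⟨sign F (g (v, 0) (0, w)) • (e _ v ⊗ₜ e _ w), ?_⟩
    have : ((v, w) : V₁ × V₂) = (v, 0) + (0, w) := by simp
    rw [this, e_add]
    refine (map_smul _ _ _).trans (congrArg _ ?_)
    refine (Algebra.TensorProduct.lift_tmul _ _ _ _ _).trans ?_
    rw [map_e, map_e]
    rfl

end TwistedAlgebra

/-- Every algebra `ℭ(V, g)` with `g v v = Q v` is isomorphic to `A`. -/
def IsTwistedModel (F : Type*) {V : Type*} (A : Type*) [Field F] [AddCommGroup V]
    [Module (ZMod 2) V] [Ring A] [Algebra F A] (Q : QuadraticForm (ZMod 2) V) : Prop :=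
  ∀ g : LinearMap.BilinForm (ZMod 2) V, (∀ v, g v v = Q v) →
    Nonempty (TwistedAlgebra F g ≃ₐ[F] A)

theorem polar_eq_of_apply_self {V : Type*} [AddCommGroup V] [Module (ZMod 2) V]
    {Q : QuadraticForm (ZMod 2) V} {g : LinearMap.BilinForm (ZMod 2) V} (hg : ∀ v, g v v = Q v)
    (v w : V) : QuadraticMap.polar Q v w = g v w + g w v := by
  simp [QuadraticMap.polar, ← hg]
  ring

/-! ### Models under isometry and orthogonal sum -/

namespace IsTwistedModel

variable {F V V₁ V₂ A B : Type*} [Field F] [AddCommGroup V] [Module (ZMod 2) V]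
  [AddCommGroup V₁] [Module (ZMod 2) V₁] [AddCommGroup V₂] [Module (ZMod 2) V₂]
  [Ring A] [Algebra F A] [Ring B] [Algebra F B]
  {Q : QuadraticForm (ZMod 2) V} {Q₁ : QuadraticForm (ZMod 2) V₁}
  {Q₂ : QuadraticForm (ZMod 2) V₂}

theorem congr (h : IsTwistedModel F A Q) (f : A ≃ₐ[F] B) : IsTwistedModel F B Q :=
  fun g hg => (h g hg).map fun f' => f'.trans f

theorem of_equivalent [Finite V] (h : IsTwistedModel F A Q₁) (f : Q₁.Equivalent Q) :
    IsTwistedModel F A Q := by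
  obtain ⟨φ⟩ := f
  intro g hg
  obtain ⟨f₁⟩ := TwistedAlgebra.nonempty_algEquiv_compl₁₂ (F := F) g φ.toLinearEquiv
  obtain ⟨f₂⟩ := h (g.compl₁₂ φ.toLinearEquiv.toLinearMap φ.toLinearEquiv.toLinearMap)
    (fun v => by simp [hg])
  exact ⟨f₁.trans f₂⟩

theorem prod [Finite V₁] [Finite V₂] (h₁ : IsTwistedModel F A Q₁) (h₂ : IsTwistedModel F B Q₂) :
    IsTwistedModel F (A ⊗[F] B) (Q₁.prod Q₂) := by
  intro g hg
  obtain ⟨f₁⟩ := h₁ (g.compl₁₂ (LinearMap.inl _ _ _) (LinearMap.inl _ _ _))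
    (fun v => by simp [hg])
  obtain ⟨f₂⟩ := h₂ (g.compl₁₂ (LinearMap.inr _ _ _) (LinearMap.inr _ _ _))
    (fun v => by simp [hg])
  obtain ⟨f⟩ := TwistedAlgebra.nonempty_algEquiv_tensorProduct (F := F) g fun v w => by
    have := polar_eq_of_apply_self hg (v, 0) (0, w)
    rw [QuadraticMap.polar_prod] at this
    simpa [QuadraticMap.polar, CharTwo.add_eq_zero] using this.symm
  exact ⟨f.trans (Algebra.TensorProduct.congr f₁ f₂)⟩

end IsTwistedModel

/-! ### Algebras of planes and lines -/

open Quaternion in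
-- Since `g(v, w) + g(w, v) = 1` on the standard basis, the two generators anticommute, and their
-- squares are the signs of `Q`: these are the quaternion relations.
theorem IsTwistedModel.quaternionAlgebra (F : Type*) [Field F]
    (Q : QuadraticForm (ZMod 2) (Fin 2 → ZMod 2)) (h : QuadraticMap.polar Q ![1, 0] ![0, 1] = 1) :
    IsTwistedModel F ℍ[F, TwistedAlgebra.sign F (Q ![1, 0]), 0,
      TwistedAlgebra.sign F (Q ![0, 1])] Q := by
  intro g hg
  rw [polar_eq_of_apply_self hg] at h
  let B : QuaternionAlgebra.Basis (TwistedAlgebra F g) (TwistedAlgebra.sign F (Q ![1, 0])) 0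
      (TwistedAlgebra.sign F (Q ![0, 1])) :=
    { i := TwistedAlgebra.e g ![1, 0]
      j := TwistedAlgebra.e g ![0, 1]
      k := TwistedAlgebra.e g ![1, 0] * TwistedAlgebra.e g ![0, 1]
      i_mul_i := by
        rw [TwistedAlgebra.e_mul_self, hg, zero_smul, add_zero, Algebra.algebraMap_eq_smul_one]
      j_mul_j := by
        rw [TwistedAlgebra.e_mul_self, hg, Algebra.algebraMap_eq_smul_one]
      i_mul_j := rfl
      j_mul_i := by
        have h' : g ![0, 1] ![1, 0] = g ![1, 0] ![0, 1] + 1 := by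
          exact (CharTwo.add_eq_iff_eq_add.1 ((add_comm _ _).trans h)).trans (add_comm _ _)
        rw [TwistedAlgebra.e_mul_e, TwistedAlgebra.e_mul_e, h', TwistedAlgebra.sign_add,
          TwistedAlgebra.sign_one, add_comm ![0, 1], zero_smul]
        simp }
  refine TwistedAlgebra.nonempty_algEquiv_of_e_mem_range g ?_ B.liftHom fun v => ?_
  · simp [QuaternionAlgebra.finrank_eq_four]
  · rw [QuaternionAlgebra.Basis.range_liftHom]
    have hi : TwistedAlgebra.e g ![1, 0] ∈ Algebra.adjoin F {B.i, B.j, B.k} :=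
      Algebra.subset_adjoin (by simp [B])
    have hj : TwistedAlgebra.e g ![0, 1] ∈ Algebra.adjoin F {B.i, B.j, B.k} :=
      Algebra.subset_adjoin (by simp [B])
    have hv : v = 0 ∨ v = ![1, 0] ∨ v = ![0, 1] ∨ v = ![1, 0] + ![0, 1] := by
      revert v
      decide
    rcases hv with rfl | rfl | rfl | rfl
    · exact one_mem _
    · exact hi
    · exact hj
    · rw [TwistedAlgebra.e_add]
      exact Subalgebra.smul_mem _ (mul_mem hi hj) _

/-- The single generator `e_1` has square `(-1)^{Q(1)}`. The polynomial is constrained by an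
equation so that `X² + 1` and `X² - 1` both fit. -/
theorem IsTwistedModel.adjoinRoot {F : Type*} [Field F] (Q : QuadraticForm (ZMod 2) (ZMod 2))
    (p : Polynomial F) (hp : p.natDegree = 2)
    (h : p = Polynomial.X ^ 2 - Polynomial.C (TwistedAlgebra.sign F (Q 1))) :
    IsTwistedModel F (AdjoinRoot p) Q := by
  intro g hg
  have hp0 : p ≠ 0 := by
    rintro rfl
    simp at hp
  have := (AdjoinRoot.powerBasis hp0).finite
  have hx : ∀ q ∈ Ideal.span {p}, Polynomial.aeval (TwistedAlgebra.e (R := F) g 1) q = 0 := by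
    intro q hq
    obtain ⟨q, rfl⟩ := Ideal.mem_span_singleton.1 hq
    rw [map_mul, h, map_sub, Polynomial.aeval_X_pow, Polynomial.aeval_C, pow_two,
      TwistedAlgebra.e_mul_self, hg, sub_self, zero_mul]
  let f : AdjoinRoot p →ₐ[F] TwistedAlgebra F g :=
    Ideal.Quotient.liftₐ (Ideal.span {p}) (Polynomial.aeval (TwistedAlgebra.e g 1)) hx
  refine TwistedAlgebra.nonempty_algEquiv_of_e_mem_range g ?_ f fun v => ?_
  · rw [(AdjoinRoot.powerBasis hp0).finrank, AdjoinRoot.powerBasis_dim, hp, Nat.card_zmod]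
  · have hv : v = 0 ∨ v = 1 := by
      revert v
      decide
    rcases hv with rfl | rfl
    · exact one_mem _
    · exact ⟨AdjoinRoot.root p, Polynomial.aeval_X _⟩

/-! ### Splitting the small algebras -/

theorem AdjoinRoot.nonempty_algEquiv_pi_of_roots {F : Type*} [Field F] {p : Polynomial F}
    (hp : p.natDegree = 2) {a b : F} (hab : a ≠ b) (ha : p.eval a = 0) (hb : p.eval b = 0) :
    Nonempty (AdjoinRoot p ≃ₐ[F] (Fin 2 → F)) := by
  have hp0 : p ≠ 0 := by
    rintro rfl
    simp at hp
  have := (AdjoinRoot.powerBasis hp0).finite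
  have hx (c : Fin 2) : Polynomial.eval₂ (Algebra.ofId F F : F →+* F) (![a, b] c) p = 0 := by
    change Polynomial.eval₂ (RingHom.id F) _ p = 0
    fin_cases c <;> simpa [Polynomial.eval₂_id]
  refine AlgHom.nonempty_algEquiv_of_surjective (AlgHom.pi fun c =>
    AdjoinRoot.liftAlgHom p (Algebra.ofId F F) (![a, b] c) (hx c)) (fun y => ?_) ?_
  · have : a - b ≠ 0 := sub_ne_zero.2 hab
    -- Lagrange interpolation with values `y 0` at `a` and `y 1` at `b`.
    refine ⟨algebraMap F _ ((y 0 - y 1) / (a - b)) * (AdjoinRoot.root p - algebraMap F _ b) +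
      algebraMap F _ (y 1), ?_⟩
    ext c
    rw [AlgHom.pi_apply, map_add, map_mul, map_sub, AlgHom.commutes, AlgHom.commutes,
      AlgHom.commutes, AdjoinRoot.liftAlgHom_root]
    fin_cases c
    · simp [this]
    · simp
  · rw [(AdjoinRoot.powerBasis hp0).finrank, AdjoinRoot.powerBasis_dim, hp]
    simp

open Quaternion in
theorem QuaternionAlgebra.nonempty_algEquiv_matrix_one {F : Type*} [Field F] (h2 : (2 : F) ≠ 0) :
    Nonempty (ℍ[F, 1, 0, 1] ≃ₐ[F] Matrix (Fin 2) (Fin 2) F) := by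
  let B : QuaternionAlgebra.Basis (Matrix (Fin 2) (Fin 2) F) (1 : F) 0 1 :=
    { i := !![1, 0; 0, -1]
      j := !![0, 1; 1, 0]
      k := !![0, 1; -1, 0]
      i_mul_i := by ext i j; fin_cases i <;> fin_cases j <;> simp
      j_mul_j := by ext i j; fin_cases i <;> fin_cases j <;> simp
      i_mul_j := by ext i j; fin_cases i <;> fin_cases j <;> simp
      j_mul_i := by ext i j; fin_cases i <;> fin_cases j <;> simp }
  refine AlgHom.nonempty_algEquiv_of_surjective B.liftHom (fun m => ?_) ?_
  · refine ⟨⟨(m 0 0 + m 1 1) / 2, (m 0 0 - m 1 1) / 2, (m 0 1 + m 1 0) / 2,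
      (m 0 1 - m 1 0) / 2⟩, ?_⟩
    ext i j
    fin_cases i <;> fin_cases j <;> 
      simp [QuaternionAlgebra.Basis.lift, B, Matrix.algebraMap_matrix_apply] <;> field_simp <;> ring
  · rw [QuaternionAlgebra.finrank_eq_four, Module.finrank_matrix]
    simp

open Quaternion in
-- A traceless symmetric matrix with entries `x, y` squares to `x² + y² = -1` and anticommutes with
-- the rotation `j`.
theorem QuaternionAlgebra.nonempty_algEquiv_matrix_neg_one {F : Type*} [Field F] (h2 : (2 : F) ≠ 0) {x y : F}
    (hxy : x ^ 2 + y ^ 2 = -1) :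
    Nonempty (ℍ[F, -1, 0, -1] ≃ₐ[F] Matrix (Fin 2) (Fin 2) F) := by
  let B : QuaternionAlgebra.Basis (Matrix (Fin 2) (Fin 2) F) (-1 : F) 0 (-1) :=
    { i := !![x, y; y, -x]
      j := !![0, 1; -1, 0]
      k := !![-y, x; x, y]
      i_mul_i := by
        ext i j
        fin_cases i <;> fin_cases j <;> simp
        · linear_combination hxy
        · ring
        · ring
        · linear_combination hxy
      j_mul_j := by ext i j; fin_cases i <;> fin_cases j <;> simp
      i_mul_j := by ext i j; fin_cases i <;> fin_cases j <;> simp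
      j_mul_i := by ext i j; fin_cases i <;> fin_cases j <;> simp }
  refine AlgHom.nonempty_algEquiv_of_surjective B.liftHom (fun m => ?_) ?_
  -- The coordinates are `tr(m)/2` and `-tr(mu)/2` for `u = i, j, k`: these three are traceless,
  -- anticommute pairwise and have square `-1`.
  · refine ⟨⟨(m 0 0 + m 1 1) / 2, -((m 0 0 - m 1 1) * x + (m 0 1 + m 1 0) * y) / 2,
      (m 0 1 - m 1 0) / 2, ((m 0 0 - m 1 1) * y - (m 0 1 + m 1 0) * x) / 2⟩, ?_⟩
    ext i j
    fin_cases i <;> fin_cases j <;> 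
      simp [QuaternionAlgebra.Basis.lift, B, Matrix.algebraMap_matrix_apply] <;> field_simp
    · linear_combination (m 1 1 - m 0 0) * hxy
    · linear_combination (- m 0 1 - m 1 0) * hxy
    · linear_combination (- m 0 1 - m 1 0) * hxy
    · linear_combination (m 0 0 - m 1 1) * hxy
  · rw [QuaternionAlgebra.finrank_eq_four, Module.finrank_matrix]
    simp

/-! ### Tensor powers of the matrix algebra and of split algebras -/

theorem PiTensorProduct.map_mul_of_tprod {ι R B : Type*} {A : ι → Type*} [CommRing R]
    [∀ i, Ring (A i)] [∀ i, Algebra R (A i)] [Ring B] [Algebra R B] (f : (⨂[R] i, A i) →ₗ[R] B)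
    (h : ∀ a b : ∀ i, A i, f (tprod R (a * b)) = f (tprod R a) * f (tprod R b))
    (x y : ⨂[R] i, A i) : f (x * y) = f x * f y := by
  refine (LinearMap.map_mul_iff f).2 ?_ x y
  ext a b
  simpa using h a b

theorem MatTensor.nonempty_algEquiv_zero (F : Type*) [Field F] :
    Nonempty (MatTensor F 0 ≃ₐ[F] F) := by
  refine ⟨AlgEquiv.ofLinearEquiv (PiTensorProduct.isEmptyEquiv (Fin 0)) ?_ fun x y => ?_⟩
  · rw [PiTensorProduct.one_def, PiTensorProduct.isEmptyEquiv_apply_tprod]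
  · exact PiTensorProduct.map_mul_of_tprod _ (fun a b => by simp) x y

theorem MatTensor.nonempty_algEquiv_succ (F : Type*) [Field F] (k : ℕ) :
    Nonempty (MatTensor F (k + 1) ≃ₐ[F] MatTensor F k ⊗[F] Matrix (Fin 2) (Fin 2) F) := by
  let f : MatTensor F (k + 1) ≃ₗ[F] MatTensor F k ⊗[F] Matrix (Fin 2) (Fin 2) F :=
    PiTensorProduct.reindex F (fun _ => Matrix (Fin 2) (Fin 2) F) finSumFinEquiv.symm ≪≫ₗ
      (PiTensorProduct.tmulEquiv F (Matrix (Fin 2) (Fin 2) F)).symm ≪≫ₗ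
      TensorProduct.congr (LinearEquiv.refl F _) (PiTensorProduct.subsingletonEquiv (0 : Fin 1))
  have hf (a : Fin (k + 1) → Matrix (Fin 2) (Fin 2) F) : f (PiTensorProduct.tprod F a) =
      PiTensorProduct.tprod F (fun i => a i.castSucc) ⊗ₜ a (Fin.last k) := by
    simp only [f, LinearEquiv.trans_apply, PiTensorProduct.reindex_tprod]
    erw [PiTensorProduct.tmulEquiv_symm_apply]
    simp [PiTensorProduct.subsingletonEquiv_apply_tprod]
    rfl
  refine ⟨AlgEquiv.ofLinearEquiv f ?_ fun x y => ?_⟩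
  · rw [PiTensorProduct.one_def, hf]
    rfl
  · refine PiTensorProduct.map_mul_of_tprod
      (B := MatTensor F k ⊗[F] Matrix (Fin 2) (Fin 2) F) f.toLinearMap (fun a b => ?_) x y
    simp only [LinearEquiv.coe_coe, hf, Algebra.TensorProduct.tmul_mul_tmul]
    rw [PiTensorProduct.tprod_mul_tprod]
    rfl

theorem nonempty_algEquiv_pi_tensorProduct (F : Type*) [Field F] (a b : ℕ) :
    Nonempty ((Fin a → F) ⊗[F] (Fin b → F) ≃ₐ[F] (Fin (a * b) → F)) := by
  let f : (Fin b → Fin a → F) ≃ₐ[F] (Fin (a * b) → F) :=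
    AlgEquiv.ofLinearEquiv ((LinearEquiv.curry F F (Fin b) (Fin a)).symm ≪≫ₗ
      LinearEquiv.funCongrLeft F F (finProdFinEquiv.symm.trans (Equiv.prodComm _ _)))
      (by ext; rfl) (fun x y => by ext; rfl)
  exact ⟨(Algebra.TensorProduct.piScalarRight F F (Fin a → F) (Fin b)).trans f⟩

/-- The sum `∑ (-1) ^ Q(v)` over all vectors `v`. -/
noncomputable def signSum {V : Type*} [AddCommGroup V] [Module (ZMod 2) V]
    (Q : QuadraticForm (ZMod 2) V) : ℤ :=
  ∑ᶠ v, TwistedAlgebra.sign ℤ (Q v)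

theorem mem_radPolar {V : Type*} [AddCommGroup V] [Module (ZMod 2) V]
    {Q : QuadraticForm (ZMod 2) V} {v : V} :
    v ∈ radPolar Q ↔ ∀ w, QuadraticMap.polar Q v w = 0 := by
  simp [radPolar, LinearMap.ext_iff]

/-- `Q` lives on a `d`-dimensional space, its polar form has `ρ`-dimensional radical,
`∑ (-1) ^ Q(v) = γ`, and its twisted group algebra over `F` is isomorphic to `A`. -/
structure HasInvariants (F A : Type*) {V : Type*} [Field F] [Ring A] [Algebra F A] [AddCommGroup V]
    [Module (ZMod 2) V] (Q : QuadraticForm (ZMod 2) V) (d ρ : ℕ) (γ : ℤ) : Prop where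
  finrank_eq : Module.finrank (ZMod 2) V = d
  finrank_radPolar : Module.finrank (ZMod 2) (radPolar Q) = ρ
  signSum_eq : signSum Q = γ
  isTwistedModel : IsTwistedModel F A Q

/-! ### Invariants of orthogonal sums and of the basic pieces -/

namespace HasInvariants

variable {F A B V V₁ V₂ : Type*} [Field F] [Ring A] [Algebra F A] [Ring B] [Algebra F B]
  [AddCommGroup V] [Module (ZMod 2) V] [AddCommGroup V₁] [Module (ZMod 2) V₁]
  [AddCommGroup V₂] [Module (ZMod 2) V₂] {Q : QuadraticForm (ZMod 2) V}
  {Q₁ : QuadraticForm (ZMod 2) V₁} {Q₂ : QuadraticForm (ZMod 2) V₂} {d d₁ d₂ ρ ρ₁ ρ₂ : ℕ}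
  {γ γ₁ γ₂ : ℤ}

theorem congr (h : HasInvariants F A Q d ρ γ) (f : A ≃ₐ[F] B) : HasInvariants F B Q d ρ γ :=
  { h with isTwistedModel := h.isTwistedModel.congr f }

theorem of_equivalent [Finite V] (h : HasInvariants F A Q₁ d ρ γ) (f : Q₁.Equivalent Q) :
    HasInvariants F A Q d ρ γ := by
  obtain ⟨φ⟩ := id f
  refine ⟨?_, ?_, ?_, h.isTwistedModel.of_equivalent f⟩
  · rw [← h.finrank_eq, φ.toLinearEquiv.finrank_eq]
  · have : (radPolar Q₁).map φ.toLinearEquiv.toLinearMap = radPolar Q := by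
      have hp (v w) : QuadraticMap.polar Q (φ v) (φ w) = QuadraticMap.polar Q₁ v w := by
        rw [QuadraticMap.polar, QuadraticMap.polar, ← map_add, φ.map_app, φ.map_app, φ.map_app]
      ext v
      obtain ⟨v, rfl⟩ := φ.toLinearEquiv.surjective v
      rw [Submodule.mem_map_equiv, LinearEquiv.symm_apply_apply, mem_radPolar, mem_radPolar]
      refine ⟨fun hv w => ?_, fun hv w => (hp v w).symm.trans (hv _)⟩
      obtain ⟨w, rfl⟩ := φ.toLinearEquiv.surjective w
      exact (hp v w).trans (hv w)
    rw [← h.finrank_radPolar, ← this, LinearEquiv.finrank_map_eq]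
  · rw [← h.signSum_eq, signSum, signSum]
    exact (finsum_eq_of_bijective φ φ.toEquiv.bijective (by simp)).symm

/-- The polar form is a sum, so its radical is the product of the radicals; the sign is
multiplicative, so the double sum factors. -/
theorem prod [Finite V₁] [Finite V₂] (h₁ : HasInvariants F A Q₁ d₁ ρ₁ γ₁)
    (h₂ : HasInvariants F B Q₂ d₂ ρ₂ γ₂) :
    HasInvariants F (A ⊗[F] B) (Q₁.prod Q₂) (d₁ + d₂) (ρ₁ + ρ₂) (γ₁ * γ₂) := by
  refine ⟨?_, ?_, ?_, h₁.isTwistedModel.prod h₂.isTwistedModel⟩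
  · rw [Module.finrank_prod, h₁.finrank_eq, h₂.finrank_eq]
  · have : radPolar (Q₁.prod Q₂) = (radPolar Q₁).prod (radPolar Q₂) := by
      ext ⟨v, w⟩
      simp only [mem_radPolar, Submodule.mem_prod, QuadraticMap.polar_prod, Prod.forall]
      refine ⟨fun h => ⟨fun a => by simpa using h a 0, fun b => by simpa using h 0 b⟩,
        fun h a b => by rw [h.1, h.2, add_zero]⟩
    let f : (radPolar Q₁).prod (radPolar Q₂) ≃ₗ[ZMod 2] radPolar Q₁ × radPolar Q₂ :=
      { toFun := fun x => (⟨x.1.1, x.2.1⟩, ⟨x.1.2, x.2.2⟩)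
        invFun := fun x => ⟨(x.1, x.2), x.1.2, x.2.2⟩
        map_add' := fun _ _ => rfl
        map_smul' := fun _ _ => rfl }
    rw [this, f.finrank_eq, Module.finrank_prod,
      h₁.finrank_radPolar, h₂.finrank_radPolar]
  · have := Fintype.ofFinite V₁
    have := Fintype.ofFinite V₂
    rw [← h₁.signSum_eq, ← h₂.signSum_eq, signSum, signSum, signSum,
      finsum_eq_sum_of_fintype, finsum_eq_sum_of_fintype, finsum_eq_sum_of_fintype,
      Fintype.sum_mul_sum, Fintype.sum_prod_type]
    simp [TwistedAlgebra.sign_add]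

theorem of_subsingleton [Subsingleton V] : HasInvariants F F Q 0 0 1 := by
  refine ⟨Module.finrank_zero_of_subsingleton, Module.finrank_zero_of_subsingleton, ?_, ?_⟩
  · rw [signSum, finsum_eq_single _ 0 fun v hv => (hv (Subsingleton.elim _ _)).elim]
    simp [TwistedAlgebra.sign]
  · intro g _
    refine TwistedAlgebra.nonempty_algEquiv_of_e_mem_range g (by simp)
      (Algebra.ofId F (TwistedAlgebra F g)) fun v => ?_
    rw [Subsingleton.elim v 0]
    exact one_mem _

/-- Three of the four vectors are zeros of the form, so the sum is `3 - 1`; both standard basis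
vectors are among them. -/
theorem plusPlane (h2 : (2 : F) ≠ 0) :
    HasInvariants F (Matrix (Fin 2) (Fin 2) F) plusPlane 2 0 2 := by
  have hp : ∀ v w, QuadraticMap.polar _root_.plusPlane v w = v 0 * w 1 + v 1 * w 0 := by
    intro v w
    simp [QuadraticMap.polar, _root_.plusPlane]
    ring
  refine ⟨by simp, ?_, ?_, ?_⟩
  · rw [Submodule.finrank_eq_zero, eq_bot_iff]
    intro v hv
    rw [mem_radPolar] at hv
    have h0 := hv ![0, 1]
    have h1 := hv ![1, 0]
    rw [hp] at h0 h1
    ext i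
    fin_cases i
    · simpa using h0
    · simpa using h1
  · rw [signSum, finsum_eq_sum_of_fintype]
    simp only [_root_.plusPlane, QuadraticMap.linMulLin_apply, LinearMap.proj_apply]
    decide
  · obtain ⟨f⟩ := QuaternionAlgebra.nonempty_algEquiv_matrix_one h2
    refine IsTwistedModel.congr ?_ f
    have := IsTwistedModel.quaternionAlgebra F _root_.plusPlane (by simp [hp])
    have h0 : _root_.plusPlane ![1, 0] = 0 := by simp [_root_.plusPlane]
    have h1 : _root_.plusPlane ![0, 1] = 0 := by simp [_root_.plusPlane]
    rwa [h0, h1, TwistedAlgebra.sign_zero] at this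

open Quaternion in
-- Every nonzero vector has value `1`, so the sum is `1 - 3`.
theorem minusPlane : HasInvariants F ℍ[F, -1, 0, -1] minusPlane 2 0 (-2) := by
  have hp : ∀ v w, QuadraticMap.polar _root_.minusPlane v w = v 0 * w 1 + v 1 * w 0 := by
    intro v w
    simp only [QuadraticMap.polar, _root_.minusPlane, add_apply,
      QuadraticMap.linMulLin_apply, LinearMap.proj_apply, Pi.add_apply]
    linear_combination (v 0 * w 0 + v 1 * w 1) * (CharTwo.two_eq_zero : (2 : ZMod 2) = 0)
  refine ⟨by simp, ?_, ?_, ?_⟩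
  · rw [Submodule.finrank_eq_zero, eq_bot_iff]
    intro v hv
    rw [mem_radPolar] at hv
    have h0 := hv ![0, 1]
    have h1 := hv ![1, 0]
    rw [hp] at h0 h1
    ext i
    fin_cases i
    · simpa using h0
    · simpa using h1
  · rw [signSum, finsum_eq_sum_of_fintype]
    simp only [_root_.minusPlane, QuadraticMap.linMulLin_apply, LinearMap.proj_apply,
      add_apply]
    decide
  · have := IsTwistedModel.quaternionAlgebra F _root_.minusPlane (by simp [hp])
    have h0 : _root_.minusPlane ![1, 0] = 1 := by simp [_root_.minusPlane]
    have h1 : _root_.minusPlane ![0, 1] = 1 := by simp [_root_.minusPlane]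
    rwa [h0, h1, TwistedAlgebra.sign_one] at this

theorem zeroLine : HasInvariants F (GaussExt F) zeroLine 1 1 0 := by
  refine ⟨by simp, ?_, ?_, ?_⟩
  · have : radPolar _root_.zeroLine = ⊤ := by
      rw [eq_top_iff]
      intro v _
      rw [mem_radPolar]
      intro w
      simp only [QuadraticMap.polar, _root_.zeroLine, QuadraticMap.sq_apply]
      linear_combination v * w * (CharTwo.two_eq_zero : (2 : ZMod 2) = 0)
    rw [this]
    simp
  · rw [signSum, finsum_eq_sum_of_fintype]
    simp only [_root_.zeroLine, QuadraticMap.sq_apply]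
    decide
  · refine IsTwistedModel.adjoinRoot _ _ (by compute_degree!) ?_
    simp [_root_.zeroLine, TwistedAlgebra.sign_one]

end HasInvariants

/-- Each coordinate contributes a factor `F[X]/(X² - 1)`, which is `F²` because `1 ≠ -1`. -/
theorem IsTwistedModel.zero {F V : Type*} [Field F] (h2 : (2 : F) ≠ 0) [AddCommGroup V]
    [Module (ZMod 2) V] [Finite V] :
    IsTwistedModel F (Fin (2 ^ Module.finrank (ZMod 2) V) → F)
      (0 : QuadraticForm (ZMod 2) V) := by
  have key : ∀ m : ℕ, IsTwistedModel F (Fin (2 ^ m) → F)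
      (0 : QuadraticForm (ZMod 2) (Fin m → ZMod 2)) := by
    intro m
    induction m with
    | zero =>
      have := HasInvariants.of_subsingleton (F := F)
        (Q := (0 : QuadraticForm (ZMod 2) (Fin 0 → ZMod 2)))
      exact this.isTwistedModel.congr (AlgEquiv.funUnique F (Fin 1) F).symm
    | succ m ih =>
      have h1 : IsTwistedModel F (AdjoinRoot (Polynomial.X ^ 2 - Polynomial.C (1 : F)))
          (0 : QuadraticForm (ZMod 2) (ZMod 2)) :=
        IsTwistedModel.adjoinRoot _ _ (by compute_degree!) (by simp [TwistedAlgebra.sign_zero])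
      obtain ⟨f⟩ := AdjoinRoot.nonempty_algEquiv_pi_of_roots
        (p := Polynomial.X ^ 2 - Polynomial.C (1 : F)) (by compute_degree!) (a := 1) (b := -1)
        (fun h => h2 (by linear_combination h)) (by simp) (by simp)
      obtain ⟨f'⟩ := nonempty_algEquiv_pi_tensorProduct F 2 (2 ^ m)
      have := (((h1.congr f).prod ih).congr f')
      rw [← pow_succ'] at this
      refine this.of_equivalent ⟨⟨Fin.consLinearEquiv (ZMod 2) (fun _ => ZMod 2), fun v => ?_⟩⟩
      simp
  exact (key _).of_equivalent
    ⟨⟨(Module.finBasis (ZMod 2) V).equivFun.symm, fun v => by simp⟩⟩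

/-! ### Invariants of a form with a given internal decomposition -/

section Submodules

variable {V : Type*} [AddCommGroup V] [Module (ZMod 2) V] {Q : QuadraticForm (ZMod 2) V}

theorem QuadraticMap.equivalent_restrict_range {E : Type*} [AddCommGroup E] [Module (ZMod 2) E]
    {q : QuadraticForm (ZMod 2) E} (φ : E →ₗ[ZMod 2] V) (hφ : Function.Injective φ)
    (h : ∀ x, Q (φ x) = q x) : (Q.restrict (LinearMap.range φ)).Equivalent q :=
  QuadraticMap.Equivalent.symm ⟨⟨LinearEquiv.ofInjective φ hφ, h⟩⟩

theorem QuadraticMap.equivalent_restrict_top : (Q.restrict ⊤).Equivalent Q :=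
  ⟨⟨LinearEquiv.ofTop ⊤ rfl, fun _ => rfl⟩⟩

theorem QuadraticMap.equivalent_restrict_sup {A B : Submodule (ZMod 2) V} (h : Disjoint A B)
    (ho : ∀ x ∈ A, ∀ y ∈ B, QuadraticMap.polar Q x y = 0) :
    ((Q.restrict A).prod (Q.restrict B)).Equivalent (Q.restrict (A ⊔ B)) := by
  have := QuadraticMap.equivalent_restrict_range (Q := Q)
    (q := (Q.restrict A).prod (Q.restrict B)) (A.subtype.coprod B.subtype) ?_ ?_
  · rw [LinearMap.range_coprod, Submodule.range_subtype, Submodule.range_subtype] at this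
    exact this.symm
  · rw [← LinearMap.ker_eq_bot, LinearMap.ker_coprod_of_disjoint_range _ _ (by simpa using h)]
    simp
  · rintro ⟨x, y⟩
    simp [QuadraticMap.map_add, ho x x.2 y y.2]

variable {ι : Type*} {W : ι → Submodule (ZMod 2) V} {F : Type*} [Field F]

theorem polar_eq_zero_of_mem_finset_sup
    (ho : ∀ i j, i ≠ j → ∀ x ∈ W i, ∀ y ∈ W j, QuadraticMap.polar Q x y = 0) {j : ι}
    {s : Finset ι} (hj : j ∉ s) : ∀ x ∈ s.sup W, ∀ y ∈ W j, QuadraticMap.polar Q x y = 0 := by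
  intro x hx y hy
  have : s.sup W ≤ LinearMap.ker (Q.polarBilin.flip y) :=
    Finset.sup_le fun i hi x hx => ho i j (fun h => hj (h ▸ hi)) x hx y hy
  exact this hx

theorem disjoint_finset_sup (hW : iSupIndep W) {j : ι} {s : Finset ι} (hj : j ∉ s) :
    Disjoint (s.sup W) (W j) := by
  refine ((hW j).mono_right (Finset.sup_le fun i hi => ?_)).symm
  exact le_iSup₂_of_le i (fun h => hj (h ▸ hi)) le_rfl

theorem IsOrthogonalSum.iSupIndep_and_iSup_eq_top {k : ℕ} {W : Fin k → Submodule (ZMod 2) V}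
    (h : IsOrthogonalSum Q W) (hQ : Q.radical = ⊥) : iSupIndep W ∧ ⨆ i, W i = ⊤ := by
  have := (DirectSum.isInternal_submodule_iff_iSupIndep_and_iSup_eq_top _).1 h.1
  refine ⟨this.1.comp (Option.some_injective _), ?_⟩
  rw [← this.2, iSup_option]
  simp [hQ]

variable [Finite V]

theorem HasInvariants.restrict_sup {A B : Type*} [Ring A] [Algebra F A] [Ring B] [Algebra F B]
    {U U' : Submodule (ZMod 2) V} {d d' ρ ρ' : ℕ} {γ γ' : ℤ}
    (hU : HasInvariants F A (Q.restrict U) d ρ γ)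
    (hU' : HasInvariants F B (Q.restrict U') d' ρ' γ') (h : Disjoint U U')
    (ho : ∀ x ∈ U, ∀ y ∈ U', QuadraticMap.polar Q x y = 0) :
    HasInvariants F (A ⊗[F] B) (Q.restrict (U ⊔ U')) (d + d') (ρ + ρ') (γ * γ') :=
  (hU.prod hU').of_equivalent (QuadraticMap.equivalent_restrict_sup h ho)

theorem HasInvariants.restrict_finset_sup (h2 : (2 : F) ≠ 0) (hW : iSupIndep W)
    (ho : ∀ i j, i ≠ j → ∀ x ∈ W i, ∀ y ∈ W j, QuadraticMap.polar Q x y = 0) (s : Finset ι)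
    (hs : ∀ i ∈ s, (Q.restrict (W i)).Equivalent _root_.plusPlane) :
    HasInvariants F (MatTensor F s.card) (Q.restrict (s.sup W)) (2 * s.card) 0 (2 ^ s.card) := by
  classical
  induction s using Finset.induction_on with
  | empty =>
    obtain ⟨f⟩ := MatTensor.nonempty_algEquiv_zero F
    have : Subsingleton (Finset.sup ∅ W : Submodule (ZMod 2) V) := by
      rw [Finset.sup_empty]
      infer_instance
    exact HasInvariants.of_subsingleton.congr f.symm
  | insert j s hj ih =>
    obtain ⟨f⟩ := MatTensor.nonempty_algEquiv_succ F s.card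
    rw [Finset.sup_insert, Finset.card_insert_of_notMem hj, sup_comm, pow_succ, mul_add]
    exact ((ih fun i hi => hs i (Finset.mem_insert_of_mem hi)).restrict_sup
      ((HasInvariants.plusPlane h2).of_equivalent (hs j (Finset.mem_insert_self _ _)).symm)
      (disjoint_finset_sup hW hj) (polar_eq_zero_of_mem_finset_sup ho hj)).congr f.symm

/-- The exceptional summand is split off from the planes `x₁x₂`. The subtraction `k - 1` does not
truncate, since `j : Fin k` forces `k ≥ 1`. -/
theorem HasInvariants.of_iSupIndep (h2 : (2 : F) ≠ 0) {k : ℕ}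
    {W : Fin k → Submodule (ZMod 2) V} (hW : iSupIndep W) (hsup : ⨆ i, W i = ⊤)
    (ho : ∀ i j, i ≠ j → ∀ x ∈ W i, ∀ y ∈ W j, QuadraticMap.polar Q x y = 0) (j : Fin k)
    (hs : ∀ i, i ≠ j → (Q.restrict (W i)).Equivalent _root_.plusPlane)
    {A : Type*} [Ring A] [Algebra F A] {d ρ : ℕ} {γ : ℤ}
    (hj : HasInvariants F A (Q.restrict (W j)) d ρ γ) :
    HasInvariants F (MatTensor F (k - 1) ⊗[F] A) Q (2 * (k - 1) + d) ρ (2 ^ (k - 1) * γ) := by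
  have hc : (Finset.univ.erase j).card = k - 1 := by simp
  have hj' : j ∉ Finset.univ.erase j := by simp
  have := (HasInvariants.restrict_finset_sup h2 hW ho (Finset.univ.erase j)
    (fun i hi => hs i (Finset.ne_of_mem_erase hi))).restrict_sup hj
    (disjoint_finset_sup hW hj') (polar_eq_zero_of_mem_finset_sup ho hj')
  rw [sup_comm, ← Finset.sup_insert, Finset.insert_erase (Finset.mem_univ j),
    Finset.sup_univ_eq_iSup, hsup, hc, zero_add] at this
  exact this.of_equivalent QuadraticMap.equivalent_restrict_top

variable (F) in
theorem HasType.plus_invariants (h2 : (2 : F) ≠ 0) (hQ : Q.radical = ⊥)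
    (h : HasType Q .plus) : ∃ k, HasInvariants F (MatTensor F k) Q (2 * k) 0 (2 ^ k) := by
  obtain ⟨k, W, hW, h⟩ := h
  obtain ⟨hi, hs⟩ := hW.iSupIndep_and_iSup_eq_top hQ
  have := HasInvariants.restrict_finset_sup h2 hi hW.2 Finset.univ fun i _ => h i
  rw [Finset.sup_univ_eq_iSup, hs, Finset.card_univ, Fintype.card_fin] at this
  exact ⟨k, this.of_equivalent QuadraticMap.equivalent_restrict_top⟩

open Quaternion in
variable (F) in
theorem HasType.minus_invariants (h2 : (2 : F) ≠ 0) (hQ : Q.radical = ⊥)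
    (h : HasType Q .minus) :
    ∃ k, HasInvariants F (MatTensor F k ⊗[F] ℍ[F, -1, 0, -1]) Q (2 * k + 2) 0
      (2 ^ k * -2) := by
  obtain ⟨k, W, hW, j, hj, h⟩ := h
  obtain ⟨hi, hs⟩ := hW.iSupIndep_and_iSup_eq_top hQ
  exact ⟨k - 1, HasInvariants.of_iSupIndep h2 hi hs hW.2 j h
    (HasInvariants.minusPlane.of_equivalent hj.symm)⟩

variable (F) in
theorem HasType.zero_invariants (h2 : (2 : F) ≠ 0) (hQ : Q.radical = ⊥)
    (h : HasType Q .zero) :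
    ∃ k, HasInvariants F (MatTensor F k ⊗[F] GaussExt F) Q (2 * k + 1) 1 0 := by
  obtain ⟨k, W, hW, j, hj, h⟩ := h
  obtain ⟨hi, hs⟩ := hW.iSupIndep_and_iSup_eq_top hQ
  have := HasInvariants.of_iSupIndep h2 hi hs hW.2 j h
    (HasInvariants.zeroLine.of_equivalent hj.symm)
  rw [mul_zero] at this
  exact ⟨k - 1, this⟩

end Submodules

/-! ### Existence of the type -/

section Existence

variable {V : Type*} [AddCommGroup V] [Module (ZMod 2) V] {Q : QuadraticForm (ZMod 2) V}

/-- The condition imposed by `HasType` on the summands. -/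
def SummandsHaveType (Q : QuadraticForm (ZMod 2) V) {k : ℕ} (W : Fin k → Submodule (ZMod 2) V) :
    FormType → Prop
  | .plus => ∀ i, (Q.restrict (W i)).Equivalent plusPlane
  | .minus => ∃ j, (Q.restrict (W j)).Equivalent minusPlane ∧
      ∀ i, i ≠ j → (Q.restrict (W i)).Equivalent plusPlane
  | .zero => ∃ j, (Q.restrict (W j)).Equivalent zeroLine ∧
      ∀ i, i ≠ j → (Q.restrict (W i)).Equivalent plusPlane

theorem SummandsHaveType.cons {k : ℕ} {W : Fin k → Submodule (ZMod 2) V} {t : FormType}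
    (h : SummandsHaveType Q W t) {P : Submodule (ZMod 2) V}
    (hP : (Q.restrict P).Equivalent plusPlane) :
    SummandsHaveType Q (Fin.cons P W : Fin (k + 1) → Submodule (ZMod 2) V) t := by
  cases t with
  | plus => exact Fin.cases hP h
  | minus =>
    obtain ⟨j, hj, h⟩ := h
    exact ⟨j.succ, hj, Fin.cases (fun _ => hP) fun i hi => h i fun hij => hi (hij ▸ rfl)⟩
  | zero =>
    obtain ⟨j, hj, h⟩ := h
    exact ⟨j.succ, hj, Fin.cases (fun _ => hP) fun i hi => h i fun hij => hi (hij ▸ rfl)⟩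

/-- The subspace `U` is an orthogonal direct sum of subspaces as in `HasType Q t`. -/
def DecomposesAs (Q : QuadraticForm (ZMod 2) V) (U : Submodule (ZMod 2) V) (t : FormType) : Prop :=
  ∃ (k : ℕ) (W : Fin k → Submodule (ZMod 2) V), iSupIndep W ∧ ⨆ i, W i = U ∧
    (∀ i j, i ≠ j → ∀ x ∈ W i, ∀ y ∈ W j, QuadraticMap.polar Q x y = 0) ∧ SummandsHaveType Q W t

/-- Modularity is what lets `P` be moved to the other side: `P` is disjoint from the join of all `W
i`, so adding it to the join of the others keeps it disjoint from `W i`. -/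
theorem iSupIndep_fin_cons {α : Type*} [CompleteLattice α] [IsModularLattice α] {k : ℕ}
    {W : Fin k → α} {P : α} (hW : iSupIndep W) (hP : Disjoint P (⨆ i, W i)) :
    iSupIndep (Fin.cons P W : Fin (k + 1) → α) := by
  refine Fin.cases ?_ fun i => ?_
  · refine hP.mono_right (iSup₂_le (Fin.cases (fun h => (h rfl).elim) fun i _ => ?_))
    exact le_iSup W i
  · have h : Disjoint (W i) ((⨆ j, ⨆ (_ : j ≠ i), W j) ⊔ P) :=
      (hW i).disjoint_sup_right_of_disjoint_sup_left
        (hP.symm.mono_left (sup_le (le_iSup W i) (iSup₂_le fun j _ => le_iSup W j)))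
    refine h.mono_right (iSup₂_le (Fin.cases (fun _ => le_sup_right) fun j hj => ?_))
    exact le_sup_of_le_left (le_iSup₂_of_le j (fun hji => hj (hji ▸ rfl)) le_rfl)

theorem DecomposesAs.sup {P U : Submodule (ZMod 2) V} {t : FormType} (h : DecomposesAs Q U t)
    (hP : (Q.restrict P).Equivalent plusPlane) (hPU : Disjoint P U)
    (ho : ∀ x ∈ P, ∀ y ∈ U, QuadraticMap.polar Q x y = 0) : DecomposesAs Q (P ⊔ U) t := by
  obtain ⟨k, W, hW, rfl, hWo, ht⟩ := h
  refine ⟨k + 1, Fin.cons P W, iSupIndep_fin_cons hW hPU, ?_, ?_, ht.cons hP⟩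
  · refine le_antisymm (iSup_le (Fin.cases le_sup_left fun i => le_sup_of_le_right (le_iSup W i)))
      (sup_le ?_ (iSup_le fun i => ?_))
    · exact le_iSup (Fin.cons P W : Fin (k + 1) → Submodule (ZMod 2) V) 0
    · exact le_iSup (Fin.cons P W : Fin (k + 1) → Submodule (ZMod 2) V) i.succ
  · refine Fin.cases (Fin.cases (fun h => (h rfl).elim) fun j _ x hx y hy => ?_) fun i =>
      Fin.cases (fun _ x hx y hy => ?_) fun j hij x hx y hy => ?_
    · exact ho x hx y (Submodule.mem_iSup_of_mem j hy)
    · rw [QuadraticMap.polar_comm]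
      exact ho y hy x (Submodule.mem_iSup_of_mem i hx)
    · exact hWo i j (fun h => hij (h ▸ rfl)) x hx y hy

theorem SummandsHaveType.decomposesAs {U : Submodule (ZMod 2) V} {t : FormType}
    (h : SummandsHaveType Q (fun _ : Fin 1 => U) t) : DecomposesAs Q U t :=
  ⟨1, fun _ => U, iSupIndep_subsingleton _, by simp,
    fun i j hij => (hij (Subsingleton.elim _ _)).elim, h⟩

theorem DecomposesAs.hasType {t : FormType} (h : DecomposesAs Q ⊤ t) (hQ : Q.radical = ⊥) :
    HasType Q t := by
  obtain ⟨k, W, hW, hs, ho, ht⟩ := h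
  have hW' : IsOrthogonalSum Q W := by
    refine ⟨?_, ho⟩
    rw [DirectSum.isInternal_submodule_iff_iSupIndep_and_iSup_eq_top]
    refine ⟨?_, by rw [iSup_option]; simp [hs]⟩
    rintro (_ | i)
    · simp [hQ]
    · refine (hW i).mono_right (iSup₂_le ?_)
      rintro (_ | j) hj
      · simp [hQ]
      · exact le_iSup₂_of_le j (fun hji => hj (hji ▸ rfl)) le_rfl
  cases t with
  | plus => exact ⟨k, W, hW', ht⟩
  | minus => exact ⟨k, W, hW', ht⟩
  | zero => exact ⟨k, W, hW', ht⟩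

/-- The linear map `𝔽₂² → V` with `e₁ ↦ v`, `e₂ ↦ w`. -/
def pairMap (v w : V) : (Fin 2 → ZMod 2) →ₗ[ZMod 2] V :=
  (LinearMap.proj 0).smulRight v + (LinearMap.proj 1).smulRight w

theorem pairMap_apply (v w : V) (x : Fin 2 → ZMod 2) : pairMap v w x = x 0 • v + x 1 • w := by
  simp [pairMap]

theorem polar_self_eq_zero (v : V) : QuadraticMap.polar Q v v = 0 := by
  rw [QuadraticMap.polar_self, two_nsmul, CharTwo.add_self_eq_zero]

/-- Pairing with `v` reads off the coefficient of `w`, and conversely; this gives both injectivity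
and the orthogonal projection to the plane. -/
theorem polar_pairMap_left {v w : V} (h : QuadraticMap.polar Q v w = 1) (x : Fin 2 → ZMod 2) :
    QuadraticMap.polar Q (pairMap v w x) v = x 1 := by
  rw [pairMap_apply, QuadraticMap.polar_add_left, QuadraticMap.polar_smul_left,
    QuadraticMap.polar_smul_left, polar_self_eq_zero, QuadraticMap.polar_comm, h]
  simp

theorem polar_pairMap_right {v w : V} (h : QuadraticMap.polar Q v w = 1) (x : Fin 2 → ZMod 2) :
    QuadraticMap.polar Q (pairMap v w x) w = x 0 := by
  rw [pairMap_apply, QuadraticMap.polar_add_left, QuadraticMap.polar_smul_left,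
    QuadraticMap.polar_smul_left, polar_self_eq_zero, h]
  simp

theorem pairMap_injective {v w : V} (h : QuadraticMap.polar Q v w = 1) :
    Function.Injective (pairMap v w) := by
  intro x y hxy
  ext i
  fin_cases i
  · change x 0 = y 0
    rw [← polar_pairMap_right h x, hxy, polar_pairMap_right h]
  · change x 1 = y 1
    rw [← polar_pairMap_left h x, hxy, polar_pairMap_left h]

theorem apply_pairMap {v w : V} (h : QuadraticMap.polar Q v w = 1) (x : Fin 2 → ZMod 2) :
    Q (pairMap v w x) = x 0 * x 0 * Q v + x 0 * x 1 + x 1 * x 1 * Q w := by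
  rw [pairMap_apply, QuadraticMap.map_add (⇑Q), QuadraticMap.map_smul, QuadraticMap.map_smul,
    QuadraticMap.polar_smul_left, QuadraticMap.polar_smul_right, h]
  simp only [smul_eq_mul]
  ring

theorem pairMap_range_le {U : Submodule (ZMod 2) V} {v w : V} (hv : v ∈ U) (hw : w ∈ U) :
    LinearMap.range (pairMap v w) ≤ U := by
  rintro _ ⟨x, rfl⟩
  rw [pairMap_apply]
  exact U.add_mem (U.smul_mem _ hv) (U.smul_mem _ hw)

theorem ZMod.eq_one_of_ne_zero {a : ZMod 2} (h : a ≠ 0) : a = 1 := by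
  revert a
  decide

/-- Distinct nonzero vectors have polar value `1 + 1 + 1 = 1`. Three independent vectors would give
`1 = f(v + w, u) = f(v, u) + f(w, u) = 1 + 1 = 0`, so only the zero space, a line and a plane
remain. -/
theorem exists_decomposesAs_of_anisotropic (U : Submodule (ZMod 2) V)
    (h : ∀ v ∈ U, v ≠ 0 → Q v = 1) : ∃ t, DecomposesAs Q U t := by
  by_cases hU : U = ⊥
  -- The zero space is the empty sum, of type `+`.
  · exact ⟨.plus, 0, Fin.elim0, fun i => i.elim0, by simp [hU], fun i => i.elim0, fun i => i.elim0⟩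
  obtain ⟨v, hv, hv0⟩ := (Submodule.ne_bot_iff _).1 hU
  have hp : ∀ x ∈ U, ∀ y ∈ U, x ≠ 0 → y ≠ 0 → x ≠ y → QuadraticMap.polar Q x y = 1 := by
    intro x hx y hy hx0 hy0 hxy
    rw [QuadraticMap.polar, h x hx hx0, h y hy hy0, h _ (U.add_mem hx hy)]
    · decide
    · rwa [Ne, ← ZModModule.sub_eq_add, sub_eq_zero]
  by_cases hUv : U = LinearMap.range (LinearMap.toSpanSingleton (ZMod 2) V v)
  · refine ⟨.zero, SummandsHaveType.decomposesAs ⟨0, ?_, fun i hi =>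
      (hi (Subsingleton.elim _ _)).elim⟩⟩
    subst hUv
    refine QuadraticMap.equivalent_restrict_range _ ?_ fun x => ?_
    · exact LinearMap.ker_eq_bot.1 (LinearMap.ker_toSpanSingleton _ hv0)
    · simp [QuadraticMap.map_smul, h v hv hv0, zeroLine]
  have hle : LinearMap.range (LinearMap.toSpanSingleton (ZMod 2) V v) ≤ U := by
    rintro _ ⟨x, rfl⟩
    exact U.smul_mem x hv
  obtain ⟨w, hw, hwv⟩ := SetLike.exists_of_lt (lt_of_le_of_ne hle (Ne.symm hUv))
  have hw0 : w ≠ 0 := fun hw0 => hwv ⟨0, by simp [hw0]⟩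
  have hvw : v ≠ w := fun hvw => hwv ⟨1, by simp [hvw]⟩
  have hpvw := hp v hv w hw hv0 hw0 hvw
  by_cases hUvw : U = LinearMap.range (pairMap v w)
  · refine ⟨.minus, SummandsHaveType.decomposesAs ⟨0, ?_, fun i hi =>
      (hi (Subsingleton.elim _ _)).elim⟩⟩
    subst hUvw
    refine QuadraticMap.equivalent_restrict_range _ (pairMap_injective hpvw) fun x => ?_
    simp [apply_pairMap hpvw, h v hv hv0, h w hw hw0, minusPlane]
  obtain ⟨u, hu, huvw⟩ := SetLike.exists_of_lt
    (lt_of_le_of_ne (pairMap_range_le hv hw) (Ne.symm hUvw))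
  have hne : ∀ x : Fin 2 → ZMod 2, pairMap v w x ≠ u := fun x hx => huvw ⟨x, hx⟩
  have hu0 : u ≠ 0 := fun hu0 => hne 0 (by simp [hu0])
  have h1 := hp v hv u hu hv0 hu0 (by simpa [pairMap_apply] using hne ![1, 0])
  have h2 := hp w hw u hu hw0 hu0 (by simpa [pairMap_apply] using hne ![0, 1])
  have h3 := hp (v + w) (U.add_mem hv hw) u hu
    (by rwa [Ne, ← ZModModule.sub_eq_add, sub_eq_zero]) hu0
    (by simpa [pairMap_apply] using hne ![1, 1])
  rw [QuadraticMap.polar_add_left, h1, h2] at h3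
  exact absurd h3 (by decide)

/-- Induction on `U`: a nonzero singular vector lies in a plane `x₁x₂`, whose orthogonal complement
in `U` is smaller and inherits the hypothesis. -/
theorem exists_decomposesAs [Finite V] (U : Submodule (ZMod 2) V)
    (h : ∀ x ∈ U, Q x = 0 → (∀ y ∈ U, QuadraticMap.polar Q x y = 0) → x = 0) :
    ∃ t, DecomposesAs Q U t := by
  induction U using WellFoundedLT.induction with
  | ind U ih =>
  by_cases ha : ∀ v ∈ U, v ≠ 0 → Q v = 1
  · exact exists_decomposesAs_of_anisotropic U ha
  push Not at ha
  obtain ⟨v, hv, hv0, hQv⟩ := ha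
  replace hQv : Q v = 0 := by
    by_contra hne
    exact hQv (ZMod.eq_one_of_ne_zero hne)
  -- Some `w` has `f(v, w) = 1`, as `v` is not in the radical of `U`. If `Q(w) = 1`, then `v + w`
  -- serves instead: `Q(v + w) = 0 + 1 + 1 = 0`.
  obtain ⟨w, hw, hQw, hvw⟩ : ∃ w ∈ U, Q w = 0 ∧ QuadraticMap.polar Q v w = 1 := by
    by_contra! hne
    refine hv0 (h v hv hQv fun w hw => ?_)
    by_contra hvw
    replace hvw := ZMod.eq_one_of_ne_zero hvw
    have hQw : Q w = 1 := ZMod.eq_one_of_ne_zero fun hQw => hne w hw hQw hvw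
    refine hne (v + w) (U.add_mem hv hw) ?_ ?_
    · rw [QuadraticMap.map_add (⇑Q), hQv, hQw, hvw]
      decide
    · rw [QuadraticMap.polar_add_right, polar_self_eq_zero, hvw, zero_add]
  set P := LinearMap.range (pairMap v w)
  set U' := U ⊓ (LinearMap.ker (Q.polarBilin.flip v) ⊓ LinearMap.ker (Q.polarBilin.flip w))
  have hU' : ∀ x, x ∈ U' ↔ x ∈ U ∧ QuadraticMap.polar Q x v = 0 ∧ QuadraticMap.polar Q x w = 0 :=
    fun x => Iff.rfl
  have hP : (Q.restrict P).Equivalent plusPlane :=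
    QuadraticMap.equivalent_restrict_range _ (pairMap_injective hvw) fun x => by
      simp [apply_pairMap hvw, hQv, hQw, plusPlane]
  have ho : ∀ x ∈ P, ∀ y ∈ U', QuadraticMap.polar Q x y = 0 := by
    rintro _ ⟨x, rfl⟩ y hy
    rw [pairMap_apply, QuadraticMap.polar_add_left, QuadraticMap.polar_smul_left,
      QuadraticMap.polar_smul_left, QuadraticMap.polar_comm, ((hU' y).1 hy).2.1,
      QuadraticMap.polar_comm, ((hU' y).1 hy).2.2]
    simp
  have hdisj : Disjoint P U' := by
    rw [Submodule.disjoint_def]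
    rintro _ ⟨x, rfl⟩ hx
    obtain ⟨-, h1, h2⟩ := (hU' _).1 hx
    rw [polar_pairMap_left hvw] at h1
    rw [polar_pairMap_right hvw] at h2
    simp [pairMap_apply, h1, h2]
  have hsup : P ⊔ U' = U := by
    refine le_antisymm (sup_le (pairMap_range_le hv hw) inf_le_left) fun u hu => ?_
    -- The projection of `u` to the plane; the coefficient of `v` is the pairing with `w` and vice
    -- versa.
    set p := pairMap v w ![QuadraticMap.polar Q u w, QuadraticMap.polar Q u v] with hp
    have hpP : p ∈ P := ⟨_, rfl⟩
    rw [← sub_add_cancel u p, add_comm]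
    refine Submodule.add_mem_sup hpP ((hU' _).2 ⟨U.sub_mem hu (pairMap_range_le hv hw hpP), ?_, ?_⟩)
    · rw [QuadraticMap.polar_sub_left, hp, polar_pairMap_left hvw]
      simp
    · rw [QuadraticMap.polar_sub_left, hp, polar_pairMap_right hvw]
      simp
  have hlt : U' < U := by
    refine lt_of_le_of_ne inf_le_left fun hUU => ?_
    have := ((hU' w).1 (hUU ▸ hw)).2.1
    rw [QuadraticMap.polar_comm, hvw] at this
    exact one_ne_zero this
  obtain ⟨t, ht⟩ := ih U' hlt fun x hx hQx hxy => by
    refine h x (hlt.le hx) hQx fun y hy => ?_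
    rw [← hsup] at hy
    obtain ⟨p, hp, u, hu, rfl⟩ := Submodule.mem_sup.1 hy
    rw [QuadraticMap.polar_add_right, QuadraticMap.polar_comm, ho p hp x hx, hxy u hu, add_zero]
  exact ⟨t, hsup ▸ ht.sup hP hdisj ho⟩

theorem exists_hasType [Finite V] (hQ : Q.radical = ⊥) : ∃ t, HasType Q t := by
  obtain ⟨t, ht⟩ := exists_decomposesAs (Q := Q) ⊤ fun x _ hx hxy => by
    have : x ∈ Q.radical := QuadraticMap.mem_radical_iff'.2 ⟨hx, fun y => by
      rw [QuadraticMap.map_add (⇑Q), hx, hxy y trivial, zero_add, add_zero]⟩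
    rwa [hQ] at this
  exact ⟨t, ht.hasType hQ⟩

end Existence

/-! ### Uniqueness of the type and passage from `V / Rad(Q)` to `V` -/

section Radical

variable {V : Type*} [AddCommGroup V] [Module (ZMod 2) V] {Q : QuadraticForm (ZMod 2) V}

theorem inducedForm_mk (v : V) : inducedForm Q (Submodule.Quotient.mk v) = Q v := rfl

theorem radical_inducedForm : (inducedForm Q).radical = ⊥ := by
  rw [eq_bot_iff]
  intro x hx
  obtain ⟨v, rfl⟩ := Submodule.Quotient.mk_surjective _ x
  rw [QuadraticMap.mem_radical_iff'] at hx
  rw [Submodule.mem_bot, Submodule.Quotient.mk_eq_zero, QuadraticMap.mem_radical_iff']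
  exact ⟨hx.1, fun w => hx.2 (Submodule.Quotient.mk w)⟩

/-- Any linear section `s` of the quotient map works: adding an element of `Rad(Q)` does not change
the value of `Q`. -/
theorem equivalent_inducedForm_prod_zero :
    ((inducedForm Q).prod (0 : QuadraticForm (ZMod 2) Q.radical)).Equivalent Q := by
  obtain ⟨s, hs⟩ := Q.radical.mkQ.exists_rightInverse_of_surjective Q.radical.range_mkQ
  have hs' (x) : Q.radical.mkQ (s x) = x := LinearMap.congr_fun hs x
  refine ⟨⟨LinearEquiv.ofBijective (s.coprod Q.radical.subtype) ⟨?_, fun v => ?_⟩, ?_⟩⟩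
  · rw [← LinearMap.ker_eq_bot, eq_bot_iff]
    rintro ⟨x, z⟩ h
    have h' : s x + z = 0 := h
    have hx : x = 0 := by
      have := congrArg Q.radical.mkQ h'
      simpa [hs', -Submodule.mkQ_apply, (Submodule.Quotient.mk_eq_zero _).2 z.2,
        show Q.radical.mkQ (z : V) = 0 from (Submodule.Quotient.mk_eq_zero _).2 z.2] using this
    subst hx
    simpa using h'
  · refine ⟨(Q.radical.mkQ v, ⟨v - s (Q.radical.mkQ v), ?_⟩), by simp⟩
    rw [← Submodule.Quotient.mk_eq_zero, ← Submodule.mkQ_apply, map_sub, hs', sub_self]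
  · rintro ⟨x, z⟩
    have hz := (QuadraticMap.mem_radical_iff'.1 z.2).2 (s x)
    have hx : Q (s x) = inducedForm Q x := by
      rw [← inducedForm_mk, ← Submodule.mkQ_apply, hs']
    change Q (s x + z) = inducedForm Q x + 0
    rw [add_comm, hz, hx, add_zero]

instance [Finite V] : Finite (V ⧸ Q.radical) :=
  Finite.of_surjective _ Q.radical.mkQ_surjective

variable [Finite V]

theorem existsUnique_hasType (hQ : Q.radical = ⊥) : ∃! t, HasType Q t := by
  obtain ⟨t, ht⟩ := exists_hasType hQ
  -- The sign sum does not involve the field, so any field of characteristic other than 2 will do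
  -- here.
  have h2 : (2 : ℚ) ≠ 0 := two_ne_zero
  have hsign : ∀ t, HasType Q t → SignType.sign (signSum Q) =
      (match t with | .plus => 1 | .minus => -1 | .zero => 0 : SignType) := by
    rintro (_ | _ | _) ht
    · obtain ⟨k, hk⟩ := ht.plus_invariants ℚ h2 hQ
      rw [hk.signSum_eq]
      exact sign_pos (by positivity)
    · obtain ⟨k, hk⟩ := ht.minus_invariants ℚ h2 hQ
      rw [hk.signSum_eq]
      exact sign_neg (mul_neg_of_pos_of_neg (by positivity) (by norm_num))
    · obtain ⟨k, hk⟩ := ht.zero_invariants ℚ h2 hQ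
      rw [hk.signSum_eq]
      exact sign_zero
  refine ⟨t, ht, fun t' ht' => ?_⟩
  have := (hsign t ht).symm.trans (hsign t' ht')
  cases t <;> cases t' <;> first | rfl | exact absurd this (by decide)

/-- The polar form vanishes on `Rad(Q)`, so that summand adds its full dimension to the radical of
`f`. This ties the exponent of the split factor to `r`. -/
theorem HasInvariants.of_inducedForm {F A : Type*} [Field F] [Ring A] [Algebra F A]
    (h2 : (2 : F) ≠ 0) {d ρ : ℕ} {γ : ℤ} (h : HasInvariants F A (inducedForm Q) d ρ γ) :
    Module.finrank (ZMod 2) (radPolar Q) = ρ + Module.finrank (ZMod 2) Q.radical ∧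
      IsTwistedModel F (A ⊗[F] (Fin (2 ^ Module.finrank (ZMod 2) Q.radical) → F)) Q := by
  have h0 : HasInvariants F (Fin (2 ^ Module.finrank (ZMod 2) Q.radical) → F)
      (0 : QuadraticForm (ZMod 2) Q.radical) (Module.finrank (ZMod 2) Q.radical)
      (Module.finrank (ZMod 2) Q.radical) (signSum (0 : QuadraticForm (ZMod 2) Q.radical)) := by
    refine ⟨rfl, ?_, rfl, IsTwistedModel.zero h2⟩
    have : radPolar (0 : QuadraticForm (ZMod 2) Q.radical) = ⊤ := by
      rw [eq_top_iff]
      intro v _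
      rw [mem_radPolar]
      intro w
      simp [QuadraticMap.polar]
    rw [this, finrank_top]
  have := (h.prod h0).of_equivalent equivalent_inducedForm_prod_zero
  exact ⟨this.finrank_radPolar, this.isTwistedModel⟩

end Radical

/-! ### Dependence on the field and the final theorem -/

theorem MatTensor.nonempty_algEquiv_quaternion {F : Type*} [Field F] (h2 : (2 : F) ≠ 0)
    (hF : IsTypeI F ∨ IsTypeII F) (k : ℕ) :
    Nonempty (MatTensor F k ⊗[F] QuaternionAlgebra F (-1) 0 (-1) ≃ₐ[F] MatTensor F (k + 1)) := by
  obtain ⟨x, y, hxy⟩ : ∃ x y : F, x ^ 2 + y ^ 2 = -1 := by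
    rcases hF with ⟨i, hi⟩ | ⟨-, h⟩
    · exact ⟨i, 0, by simp [hi]⟩
    · exact h
  obtain ⟨f⟩ := QuaternionAlgebra.nonempty_algEquiv_matrix_neg_one h2 hxy
  obtain ⟨f'⟩ := MatTensor.nonempty_algEquiv_succ F k
  exact ⟨(Algebra.TensorProduct.congr AlgEquiv.refl f).trans f'.symm⟩

theorem GaussExt.nonempty_algEquiv_pi {F : Type*} [Field F] (h2 : (2 : F) ≠ 0) (hF : IsTypeI F) :
    Nonempty (GaussExt F ≃ₐ[F] (Fin 2 → F)) := by
  obtain ⟨i, hi⟩ := hF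
  refine AdjoinRoot.nonempty_algEquiv_pi_of_roots (by compute_degree!) (a := i) (b := -i)
    (fun h => ?_) (by simp [hi]) (by simp [hi])
  have hi0 : i = 0 := by
    have : 2 * i = 0 := by linear_combination h
    exact (mul_eq_zero.1 this).resolve_left h2
  simp [hi0] at hi

theorem mainTheorem3 {F V : Type*} [Field F] (hF : ringChar F ≠ 2)
    [AddCommGroup V] [Module (ZMod 2) V] [FiniteDimensional (ZMod 2) V]
    (Q : QuadraticForm (ZMod 2) V)
    (g : LinearMap.BilinForm (ZMod 2) V) (hg : ∀ v, g v v = Q v)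
    (n r : ℕ) (hn : n = Module.finrank (ZMod 2) (V ⧸ Q.radical))
    (hr : r = Module.finrank (ZMod 2) (radPolar Q)) :
    (∃! t, HasType (inducedForm Q) t) ∧
    (HasType (inducedForm Q) .plus → Even n ∧
      Nonempty (TwistedAlgebra F g ≃ₐ[F] (Fin (2 ^ r) → MatTensor F (n / 2)))) ∧
    (HasType (inducedForm Q) .minus → Even n ∧ 2 ≤ n ∧
      (IsTypeI F ∨ IsTypeII F →
        Nonempty (TwistedAlgebra F g ≃ₐ[F] (Fin (2 ^ r) → MatTensor F (n / 2)))) ∧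
      (IsTypeIII F →
        Nonempty (TwistedAlgebra F g ≃ₐ[F]
          (Fin (2 ^ r) → MatTensor F ((n - 2) / 2) ⊗[F] Quaternion F)))) ∧
    (HasType (inducedForm Q) .zero → Odd n ∧ 1 ≤ r ∧
      (IsTypeI F →
        Nonempty (TwistedAlgebra F g ≃ₐ[F] (Fin (2 ^ r) → MatTensor F ((n - 1) / 2)))) ∧
      (IsTypeII F ∨ IsTypeIII F →
        Nonempty (TwistedAlgebra F g ≃ₐ[F]
          (Fin (2 ^ (r - 1)) → MatTensor F ((n - 1) / 2) ⊗[F] GaussExt F)))) := by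
  have h2 : (2 : F) ≠ 0 := Ring.two_ne_zero hF
  have : Finite V := Module.finite_of_finite (ZMod 2)
  have hQ := radical_inducedForm (Q := Q)
  refine ⟨existsUnique_hasType hQ, fun h => ?_, fun h => ?_, fun h => ?_⟩
  · obtain ⟨k, hk⟩ := h.plus_invariants F h2 hQ
    obtain ⟨hρ, hA⟩ := hk.of_inducedForm h2
    obtain ⟨f⟩ := hA g hg
    rw [hk.finrank_eq] at hn
    rw [zero_add, ← hr] at hρ
    rw [← hρ] at f
    obtain rfl : k = n / 2 := by omega
    exact ⟨⟨_, hn.trans (two_mul _)⟩,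
      ⟨f.trans (Algebra.TensorProduct.piScalarRight F F _ (Fin (2 ^ r)))⟩⟩
  · obtain ⟨k, hk⟩ := h.minus_invariants F h2 hQ
    obtain ⟨hρ, hA⟩ := hk.of_inducedForm h2
    obtain ⟨f⟩ := hA g hg
    rw [hk.finrank_eq] at hn
    rw [zero_add, ← hr] at hρ
    rw [← hρ] at f
    have f' := f.trans (Algebra.TensorProduct.piScalarRight F F _ (Fin (2 ^ r)))
    refine ⟨⟨k + 1, by omega⟩, by omega, fun hF => ?_, fun _ => ?_⟩
    · obtain ⟨f''⟩ := MatTensor.nonempty_algEquiv_quaternion h2 hF k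
      rw [show n / 2 = k + 1 by omega]
      exact ⟨f'.trans (AlgEquiv.piCongrRight fun _ => f'')⟩
    · rw [show (n - 2) / 2 = k by omega]
      exact ⟨f'⟩
  · obtain ⟨k, hk⟩ := h.zero_invariants F h2 hQ
    obtain ⟨hρ, hA⟩ := hk.of_inducedForm h2
    obtain ⟨f⟩ := hA g hg
    rw [hk.finrank_eq] at hn
    rw [← hr] at hρ
    -- The line `x²` lies in `Rad(f)` but not in `Rad(Q)`, so `r = 1 + dim Rad(Q)`.
    rw [show Module.finrank (ZMod 2) Q.radical = r - 1 by omega] at f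
    rw [show (n - 1) / 2 = k by omega]
    refine ⟨⟨k, hn⟩, by omega, fun hF => ?_, fun _ => ?_⟩
    · obtain ⟨f₁⟩ := GaussExt.nonempty_algEquiv_pi h2 hF
      obtain ⟨f₂⟩ := nonempty_algEquiv_pi_tensorProduct F 2 (2 ^ (r - 1))
      -- The splitting of `F[i]` into two copies of `F` doubles the number of factors, from
      -- `2^(r-1)` to `2^r`.
      rw [← pow_succ', show r - 1 + 1 = r by omega] at f₂
      exact ⟨f.trans <| (Algebra.TensorProduct.assoc F F F _ _ _).trans <|
        (Algebra.TensorProduct.congr AlgEquiv.refl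
          ((Algebra.TensorProduct.congr f₁ AlgEquiv.refl).trans f₂)).trans
        (Algebra.TensorProduct.piScalarRight F F _ (Fin (2 ^ r)))⟩
    · exact ⟨f.trans (Algebra.TensorProduct.piScalarRight F F _ (Fin (2 ^ (r - 1))))⟩
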